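/- Let $K$ be a perfect field of characteristic $p$, let $\overline K$ be its algebraic closure, and let $F\in K[X,Y]$ be monic in $Y$ and separable in $Y$ (i.e. separable as a polynomial in $Y$ over $K(X)$). Put $d_Y=\deg_Y F$ and assume $p=0$ or $p>d_Y$. Let $F_Y=\partial F/\partial Y$, and let $\delta$ be the $X$-adic valuation of the resultant $\operatorname{Res}_Y(F,F_Y)\in K[X]$; assume $\delta>0$ (i.e. $X=0$ is a critical point). The Puiseux series of $F$ (above $X=0$) are the roots $S$ of $F$, viewed as a polynomial in $Y$, in the field $\bigcup_{e\ge1}\overline K((X^{1/e}))$, and $\operatorname{val}$ is the $X$-adic valuation on this field, with $\operatorname{val}(X)=1$. For such an $S$: - its ramification index $e$ is the least integer $e\ge 1$ with $S\in\overline K((X^{1/e}))$; - its regularity index $r$ is the least integer $N\ge\min(0,e\operatorname{val}(S))$ such that, for every Puiseux series $S'$ of $F$, if $S$ and $S'$ have the same coefficients at all exponents $\le N/e$, then $S=S'$; - $v_S=\operatorname{val}(F_Y(X,S))$ and $N_S=\dfrac{r}{e}+v_S$. Then at least $d_Y/2$ of the Puiseux series $S$ of $F$ satisfy both $$v_S<\frac{2\delta}{d_Y}\qquad\text{and}\qquad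 N_S<\frac{4\delta}{d_Y}.$$ -/

import Mathlib

open Polynomial

noncomputable section

namespace Puiseux

/-- Hahn series with rational exponents over the algebraic closure of `K`. It is a field which
contains the field of Puiseux series `⋃ₑ K̄((X^{1/e}))` (see `IsPuiseux`). -/
abbrev Series (K : Type*) [Field K] : Type _ := HahnSeries ℚ (AlgebraicClosure K)

/-- `S ∈ K̄((X^{1/e}))`: all exponents of `S` lie in `(1/e)ℤ`. (The support of a Hahn series is
well-ordered, so that the exponents are then bounded below.) -/
def InLaurent {K : Type*} [Field K] (e : ℕ) (S : Series K) : Prop :=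
  0 < e ∧ ∀ α ∈ S.support, ∃ k : ℤ, α = (k : ℚ) / (e : ℚ)

/-- `S` is a Puiseux series: it lies in `K̄((X^{1/e}))` for some `e ≥ 1`. -/
def IsPuiseux {K : Type*} [Field K] (S : Series K) : Prop := ∃ e : ℕ, InLaurent e S

/-- The ramification index of a Puiseux series: the least `e ≥ 1` with `S ∈ K̄((X^{1/e}))`. -/
def ramificationIndex {K : Type*} [Field K] (S : Series K) : ℕ := sInf {e : ℕ | InLaurent e S}

theorem inLaurent_ramificationIndex {K : Type*} [Field K] {S : Series K} (hS : IsPuiseux S) :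
    InLaurent (ramificationIndex S) S :=
  Nat.sInf_mem hS

/-- The embedding `K[X] → K̄((X^{1/e}))`, `X ↦ X¹`. -/
def ofPoly (K : Type*) [Field K] : K[X] →+* Series K :=
  Polynomial.eval₂RingHom
    ((HahnSeries.C : AlgebraicClosure K →+* Series K).comp (algebraMap K (AlgebraicClosure K)))
    (HahnSeries.single (1 : ℚ) (1 : AlgebraicClosure K))

/-- `F(X, S)` for `F ∈ K[X][Y]`. -/
def evalAt {K : Type*} [Field K] (F : K[X][X]) (S : Series K) : Series K :=
  F.eval₂ (ofPoly K) S

/-- The (classical) Puiseux series of `F` above `0`: the roots of `F`, as a polynomial in `Y`,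
in the field of Puiseux series. -/
def puiseuxSeries {K : Type*} [Field K] (F : K[X][X]) : Set (Series K) :=
  {S | IsPuiseux S ∧ evalAt F S = 0}

/-- The truncation `∑_{α ≤ τ} c_α X^α` of `S = ∑ c_α X^α`. -/
def trunc {K : Type*} [Field K] (S : Series K) (τ : ℚ) : Series K where
  coeff α := if α ≤ τ then S.coeff α else 0
  isPWO_support' := S.isPWO_support.mono fun α hα => by
    by_cases h : α ≤ τ
    · simpa [h] using hα
    · simp [h] at hα

/-- The integers `N ≥ min(0, e·val(S))` such that the truncation of `S` at `N/e` separates `S`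
from the other Puiseux series of `F`. (`HahnSeries.order 0 = 0`; for `S = 0` the bound is `0`,
as it is with the convention `val(0) = ∞`.) -/
def regularitySet {K : Type*} [Field K] (F : K[X][X]) (S : Series K) : Set ℤ :=
  {N | min 0 ((ramificationIndex S : ℚ) * S.order) ≤ (N : ℚ) ∧
    ∀ S' ∈ puiseuxSeries F,
      trunc S ((N : ℚ) / (ramificationIndex S : ℚ)) =
        trunc S' ((N : ℚ) / (ramificationIndex S : ℚ)) → S = S'}

/-- The regularity index of a Puiseux series `S` of `F`; see `isLeast_regularityIndex`. -/
def regularityIndex {K : Type*} [Field K] (F : K[X][X]) (S : Series K) : ℤ :=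
  sInf (regularitySet F S)

/-- `v = val(F_Y(S))`, with `val(0) = ∞`. -/
def v {K : Type*} [Field K] (F : K[X][X]) (S : Series K) : WithTop ℚ :=
  (evalAt (derivative F) S).orderTop

/-- `N = r/e + v`. -/
def N {K : Type*} [Field K] (F : K[X][X]) (S : Series K) : WithTop ℚ :=
  (((regularityIndex F S : ℚ) / (ramificationIndex S : ℚ) : ℚ) : WithTop ℚ) + v F S

/-- `δ`, the `X`-adic valuation of the resultant of `F` and `F_Y` with respect to `Y`
(for separable `F` of positive degree in `Y` the resultant is nonzero). -/
def delta {K : Type*} [Field K] (F : K[X][X]) : ℕ :=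
  (Polynomial.resultant F (derivative F)).natTrailingDegree

theorem ofPoly_injective (K : Type*) [Field K] : Function.Injective (ofPoly K) := by
  have h : ∀ (p : K[X]) (n : ℕ),
      (ofPoly K p).coeff (n : ℚ) = algebraMap K (AlgebraicClosure K) (p.coeff n) := by
    intro p n
    induction p using Polynomial.induction_on' with
    | add p q hp hq => simp [hp, hq]
    | monomial m a =>
      have h1 : (HahnSeries.single (1 : ℚ) (1 : AlgebraicClosure K)) ^ m =
          HahnSeries.single (m : ℚ) 1 := by
        rw [HahnSeries.single_pow]; simp
      simp only [ofPoly, coe_eval₂RingHom, eval₂_monomial, RingHom.comp_apply, h1,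
        HahnSeries.C_apply, HahnSeries.single_mul_single, zero_add, mul_one,
        HahnSeries.coeff_single, Polynomial.coeff_monomial, Nat.cast_inj]
      by_cases hmn : m = n
      · simp [hmn]
      · simp [hmn, Ne.symm hmn]
  intro p q hpq
  ext n
  apply (algebraMap K (AlgebraicClosure K)).injective
  rw [← h, ← h, hpq]

/-- For `F ≠ 0` and a Puiseux series `S` of `F` the regularity index is attained. -/
theorem isLeast_regularityIndex {K : Type*} [Field K] {F : K[X][X]} (hF : F ≠ 0)
    {S : Series K} (hS : S ∈ puiseuxSeries F) :
    IsLeast (regularitySet F S) (regularityIndex F S) := by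
  have he : 0 < (ramificationIndex S : ℚ) := by
    exact_mod_cast (inLaurent_ramificationIndex hS.1).1
  have hfin : (puiseuxSeries F).Finite := by
    have h0 : F.map (ofPoly K) ≠ 0 :=
      (Polynomial.map_ne_zero_iff (ofPoly_injective K)).2 hF
    refine (Polynomial.finite_setOfPred_isRoot h0).subset fun T hT => ?_
    simpa [Polynomial.IsRoot, Polynomial.eval_map, evalAt] using hT.2
  have hbdd : BddBelow (regularitySet F S) :=
    ⟨⌊min 0 ((ramificationIndex S : ℚ) * S.order)⌋, fun M hM => by
      exact_mod_cast (Int.floor_le _).trans hM.1⟩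
  have hex : ∀ T : Series K, ∃ a : ℚ, ∀ τ, a ≤ τ → trunc S τ = trunc T τ → S = T := by
    intro T
    by_cases h : S = T
    · exact ⟨0, fun _ _ _ => h⟩
    · obtain ⟨a, ha⟩ : ∃ a, S.coeff a ≠ T.coeff a := by
        by_contra! hc
        exact h (HahnSeries.ext (funext hc))
      refine ⟨a, fun τ hτ heq => (ha ?_).elim⟩
      have := congrArg (fun U : Series K => U.coeff a) heq
      simpa [trunc, hτ] using this
  choose a ha using hex
  obtain ⟨b, hb⟩ := (hfin.image a).bddAbove
  have hne : (regularitySet F S).Nonempty := by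
    refine ⟨max 0 ⌈b * (ramificationIndex S : ℚ)⌉, ?_, fun T hT heq => ha T _ ?_ heq⟩
    · exact (min_le_left _ _).trans (by exact_mod_cast le_max_left _ _)
    · refine (hb ⟨T, hT, rfl⟩).trans ?_
      rw [le_div_iff₀ he]
      refine (Int.le_ceil _).trans ?_
      exact_mod_cast le_max_right _ _
  exact ⟨Int.csInf_mem hne hbdd, fun M hM => csInf_le hbdd hM⟩

end Puiseux

end

/-!
The Puiseux series of `F` are `d = deg_Y F` in number and have nonnegative valuation, since `F` is
monic, splits and is separable over the field of Puiseux series. Hence the numbers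
`v_S = ∑_{T ≠ S} val (S - T)` are nonnegative, and their sum is the valuation `δ` of the resultant
(`Puiseux.exists_finset_puiseuxSeries`). At most half of them can be `≥ 2δ/d`
(`Puiseux.half_card_le_card_filter_lt`). For the others `N_S = r/e + v_S ≤ 2 v_S < 4δ/d`, because
`r/e ≤ v_S` for every Puiseux series (`Puiseux.regularityIndex_div_le_v`): a series that agrees with
`S` up to the exponent `(r - 1)/e` has enough conjugates over `K̄((X^{1/e}))` which are at least
as close to `S`.

The splitting is Puiseux's theorem in the tame case (`Polynomial.Monic.exists_splits_map_expand`).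
It is proved over `k⟦T⟧` by the Newton polygon method: once the subleading coefficient is removed by
a translation, and the roots are divided by a power of `T` after a ramification `T ↦ T ^ m`, the
reduction of the polynomial has two coprime nonconstant factors, and the Weierstrass preparation
theorem lifts the factorization. All ramification orders used are invertible in `k`, so that the
roots of unity which define the conjugates exist.
-/

/-! ### Factoring a polynomial over a complete local ring -/

/-- A monic polynomial over a complete local ring whose reduction is divisible by `X` but is not a
power of `X` is a product of two monic polynomials of smaller degree. The first factor is the
distinguished polynomial of the Weierstrass preparation theorem. -/
theorem Polynomial.Monic.exists_mul_of_coeff_zero_mem_maximalIdeal {A : Type*} [CommRing A]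
    [IsLocalRing A] [IsAdicComplete (IsLocalRing.maximalIdeal A) A] {f : A[X]} (hf : f.Monic)
    (h0 : f.coeff 0 ∈ IsLocalRing.maximalIdeal A)
    (hne : ∃ i < f.natDegree, f.coeff i ∉ IsLocalRing.maximalIdeal A) :
    ∃ g q : A[X], g.Monic ∧ q.Monic ∧ f = g * q ∧
      g.natDegree < f.natDegree ∧ q.natDegree < f.natDegree := by
  have hmap : (f : PowerSeries A).map (IsLocalRing.residue A) ≠ 0 := by
    rw [← Polynomial.polynomial_map_coe]
    exact_mod_cast f.map_monic_ne_zero (f := IsLocalRing.residue A) hf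
  obtain ⟨g, h, H⟩ := PowerSeries.exists_isWeierstrassFactorization hmap
  have hg := H.isDistinguishedAt.monic
  -- Divisibility by `g` in power series implies divisibility in polynomials.
  obtain ⟨q, hq⟩ : g ∣ f := by
    rw [← Ideal.mem_span_singleton, ← Ideal.Quotient.eq_zero_iff_mem]
    apply H.isDistinguishedAt.algEquivQuotient.injective
    rw [map_zero, Polynomial.IsDistinguishedAt.algEquivQuotient_apply]
    simp only [Ideal.quotientMapₐ]
    refine Ideal.Quotient.eq_zero_iff_mem.2 (Ideal.mem_span_singleton.2 ⟨h, ?_⟩)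
    simpa using H.eq_mul
  have hqm : q.Monic := hg.of_mul_monic_left (hq ▸ hf)
  have hdeg : f.natDegree = g.natDegree + q.natDegree := by rw [hq, hg.natDegree_mul hqm]
  refine ⟨g, q, hg, hqm, hq, ?_, ?_⟩
  · rcases Nat.eq_zero_or_pos q.natDegree with hz | hz
    · obtain ⟨i, hi, hi'⟩ := hne
      rw [hqm.natDegree_eq_zero.1 hz, mul_one] at hq
      subst hq
      exact absurd (H.isDistinguishedAt.mem hi) hi'
    · lia
  · rcases Nat.eq_zero_or_pos g.natDegree with hz | hz
    · have h1 := H.eq_mul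
      rw [hg.natDegree_eq_zero.1 hz, Polynomial.coe_one, one_mul] at h1
      have h2 := PowerSeries.isUnit_iff_constantCoeff.1 H.isUnit
      rw [← h1, Polynomial.constantCoeff_coe] at h2
      exact absurd h2 ((IsLocalRing.mem_maximalIdeal _).1 h0)
    · lia

theorem Polynomial.Monic.taylor {R : Type*} [CommRing R] {f : R[X]} (hf : f.Monic) (c : R) :
    (Polynomial.taylor c f).Monic := by
  rw [Polynomial.taylor_apply]
  exact hf.comp_X_add_C c

/-- The coefficient just below the leading one after a translation of the variable. -/
theorem Polynomial.Monic.coeff_taylor_of_natDegree_eq_succ {R : Type*} [CommRing R] {f : R[X]}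
    (hf : f.Monic) {n : ℕ} (hn : f.natDegree = n + 1) (c : R) :
    (Polynomial.taylor c f).coeff n = f.coeff n + (n + 1 : R) * c := by
  have hd : (hasseDeriv n f).natDegree < 2 := by
    have := natDegree_hasseDeriv_le f n
    lia
  have h1 : f.coeff (n + 1) = 1 := hn ▸ hf.coeff_natDegree
  rw [taylor_coeff, eval_eq_sum_range' hd]
  simp [Finset.sum_range_succ, hasseDeriv_coeff, add_comm 1 n, h1]

instance PowerSeries.isAdicComplete_maximalIdeal (k : Type*) [Field k] :
    IsAdicComplete (IsLocalRing.maximalIdeal (PowerSeries k)) (PowerSeries k) := by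
  rw [PowerSeries.maximalIdeal_eq_span_X]
  infer_instance

theorem PowerSeries.mem_maximalIdeal_iff {k : Type*} [Field k] {a : PowerSeries k} :
    a ∈ IsLocalRing.maximalIdeal (PowerSeries k) ↔ PowerSeries.constantCoeff a = 0 := by
  rw [PowerSeries.maximalIdeal_eq_span_X, Ideal.mem_span_singleton, PowerSeries.X_dvd_iff]

/-- The coefficient below the leading one vanishes, so the reduction could be the power of a linear
polynomial only if it were a power of `X`; it therefore has two coprime factors, which lift. -/
theorem Polynomial.Monic.exists_mul_of_coeff_eq_zero {k : Type*} [Field k] [IsAlgClosed k]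
    {f : (PowerSeries k)[X]} (hf : f.Monic) {n : ℕ} (hn : f.natDegree = n + 1)
    (hk : (n + 1 : k) ≠ 0) (h0 : f.coeff n = 0)
    (hne : ∃ i < f.natDegree, PowerSeries.constantCoeff (f.coeff i) ≠ 0) :
    ∃ g q : (PowerSeries k)[X], g.Monic ∧ q.Monic ∧ f = g * q ∧
      g.natDegree < f.natDegree ∧ q.natDegree < f.natDegree := by
  set φ : PowerSeries k →+* k := PowerSeries.constantCoeff
  obtain ⟨c, hc⟩ := IsAlgClosed.exists_root (f.map φ) (by
    rw [hf.degree_map, degree_eq_natDegree hf.ne_zero, hn]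
    exact_mod_cast Nat.succ_ne_zero n)
  have hft := hf.taylor (PowerSeries.C c)
  have hmap : (Polynomial.taylor (PowerSeries.C c) f).map φ = Polynomial.taylor c (f.map φ) := by
    rw [map_taylor]
    simp [φ]
  obtain ⟨g, q, hg, hq, hgq, hgd, hqd⟩ :=
    hft.exists_mul_of_coeff_zero_mem_maximalIdeal (by
      rw [PowerSeries.mem_maximalIdeal_iff]
      change φ _ = 0
      rw [← coeff_map, hmap, taylor_coeff_zero]
      exact hc) (by
      by_contra! hcon
      have hX : Polynomial.taylor c (f.map φ) = X ^ (n + 1) := by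
        ext i
        rw [← hmap, coeff_map, coeff_X_pow]
        rcases lt_trichotomy i (n + 1) with hi | hi | hi
        · rw [if_neg hi.ne, ← PowerSeries.mem_maximalIdeal_iff]
          exact hcon i (by rwa [natDegree_taylor, hn])
        · have := hft.coeff_natDegree
          rw [natDegree_taylor, hn] at this
          rw [if_pos hi, hi, this, map_one]
        · rw [if_neg hi.ne', coeff_eq_zero_of_natDegree_lt, map_zero]
          rwa [natDegree_taylor, hn]
      have hc0 : c = 0 := by
        have h1 := (hf.map φ).coeff_taylor_of_natDegree_eq_succ
          ((hf.natDegree_map φ).trans hn) c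
        rw [hX, coeff_map, h0, map_zero, zero_add, coeff_X_pow, if_neg (by lia)] at h1
        exact (mul_eq_zero.1 h1.symm).resolve_left hk
      obtain ⟨i, hi, hi'⟩ := hne
      rw [hc0, taylor_zero] at hX
      apply hi'
      rw [← coeff_map, hX, coeff_X_pow, if_neg (by lia)])
  rw [natDegree_taylor] at hgd hqd
  refine ⟨Polynomial.taylor (-PowerSeries.C c) g, Polynomial.taylor (-PowerSeries.C c) q,
    hg.taylor _, hq.taylor _, ?_, ?_, ?_⟩
  · rw [← taylor_mul, ← hgq, taylor_taylor, neg_add_cancel, taylor_zero]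
  · rwa [natDegree_taylor]
  · rwa [natDegree_taylor]

/-! ### Puiseux's theorem -/

/-- The Newton polygon step: after a suitable ramification `T ↦ T ^ m` and a scaling of the roots
by a power of `T`, the polynomial stays integral and acquires a nonzero reduction below the leading
term. -/
theorem Polynomial.Monic.exists_map_expand_eq_scaleRoots {k : Type*} [Field k]
    {f : (PowerSeries k)[X]} (hf : f.Monic) (hne : ∃ i < f.natDegree, f.coeff i ≠ 0)
    {m : ℕ} (hm : m ≠ 0) (hdvd : ∀ j, 1 ≤ j → j ≤ f.natDegree → j ∣ m) :
    ∃ (s : ℕ) (b : (PowerSeries k)[X]), b.Monic ∧ b.natDegree = f.natDegree ∧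
      f.map (PowerSeries.expand (R := k) m hm : PowerSeries k →+* PowerSeries k) =
        b.scaleRoots (PowerSeries.X ^ s) ∧
      ∃ i < b.natDegree, PowerSeries.constantCoeff (b.coeff i) ≠ 0 := by
  classical
  set d := f.natDegree with hd
  set w : ℕ → ℕ := fun i => m / (d - i) * (f.coeff i).order.toNat with hw
  have hmul : ∀ i < d, m * (f.coeff i).order.toNat = w i * (d - i) := fun i hi => by
    have := Nat.div_mul_cancel (hdvd (d - i) (by lia) (by lia))
    rw [hw]
    nlinarith
  -- `w i` is the slope belonging to the `i`-th coefficient; take the least one.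
  obtain ⟨i₀, hi₀, hmin⟩ := Finset.exists_min_image
    ((Finset.range d).filter fun i => f.coeff i ≠ 0) w (by
      obtain ⟨i, hi, hi'⟩ := hne
      exact ⟨i, by simp [hi, hi']⟩)
  simp only [Finset.mem_filter, Finset.mem_range] at hi₀ hmin
  set s := w i₀ with hs
  set E := PowerSeries.expand (R := k) m hm
  have hEX : ∀ i, PowerSeries.X ^ (m * (f.coeff i).order.toNat) ∣ E (f.coeff i) := fun i => by
    obtain ⟨u, hu⟩ : PowerSeries.X ^ (f.coeff i).order.toNat ∣ f.coeff i :=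
      PowerSeries.X_pow_order_dvd
    refine ⟨E u, ?_⟩
    conv_lhs => rw [hu]
    rw [map_mul, map_pow, PowerSeries.expand_X, ← pow_mul]
  have hdiv : ∀ i, ∃ c : PowerSeries k,
      i < d → E (f.coeff i) = c * (PowerSeries.X ^ s) ^ (d - i) := fun i => by
    by_cases hi : i < d
    · by_cases hz : f.coeff i = 0
      · exact ⟨0, fun _ => by rw [hz, map_zero, zero_mul]⟩
      · have h1 : (PowerSeries.X ^ s) ^ (d - i) ∣ E (f.coeff i) := by
          refine dvd_trans ?_ (hEX i)
          rw [← pow_mul, hmul i hi]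
          exact pow_dvd_pow _ (Nat.mul_le_mul_right _ (hmin i ⟨hi, hz⟩))
        obtain ⟨c, hc⟩ := h1
        exact ⟨c, fun _ => by rw [hc, mul_comm]⟩
    · exact ⟨0, fun h => absurd h hi⟩
  choose c hc using hdiv
  have hlow : (∑ i ∈ Finset.range d, C (c i) * X ^ i).degree < (d : WithBot ℕ) :=
    (degree_sum_le _ _).trans_lt <| (Finset.sup_lt_iff (WithBot.bot_lt_coe d)).2 fun i hi =>
      (degree_C_mul_X_pow_le _ _).trans_lt (Nat.cast_lt.2 (Finset.mem_range.1 hi))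
  set b : (PowerSeries k)[X] := X ^ d + ∑ i ∈ Finset.range d, C (c i) * X ^ i with hb
  have hbm : b.Monic := monic_X_pow_add hlow
  have hbd : b.natDegree = d := natDegree_eq_of_degree_eq_some (by
    rw [hb, degree_add_eq_left_of_degree_lt (by rwa [degree_X_pow]), degree_X_pow])
  have hbc : ∀ i < d, b.coeff i = c i := fun i hi => by
    simp [hb, coeff_X_pow, hi.ne, hi]
  refine ⟨s, b, hbm, hbd, ?_, i₀, hbd ▸ hi₀.1, ?_⟩
  · ext1 i
    rw [coeff_map, coeff_scaleRoots, hbd]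
    rcases lt_trichotomy i d with hi | hi | hi
    · rw [hbc i hi]
      exact hc i hi
    · have h1 : b.coeff d = 1 := hbd ▸ hbm.coeff_natDegree
      rw [hi, hd, hf.coeff_natDegree, ← hd, h1, map_one, Nat.sub_self, pow_zero, one_mul]
    · rw [coeff_eq_zero_of_natDegree_lt (hd ▸ hi), coeff_eq_zero_of_natDegree_lt (hbd.symm ▸ hi),
        map_zero, zero_mul]
  · rw [hbc i₀ hi₀.1]
    intro hzero
    -- otherwise the order of `E (f.coeff i₀)` would be larger than it is
    obtain ⟨c', hc'⟩ := PowerSeries.X_dvd_iff.2 hzero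
    have h1 := hc i₀ hi₀.1
    rw [← pow_mul, ← hmul i₀ hi₀.1, hc'] at h1
    have h2 : PowerSeries.coeff (m * (f.coeff i₀).order.toNat) (E (f.coeff i₀)) = 0 := by
      refine PowerSeries.X_pow_dvd_iff.1 ⟨c', ?_⟩ _ (Nat.lt_succ_self _)
      rw [h1, Nat.succ_eq_add_one, pow_succ]
      ring
    rw [PowerSeries.coeff_expand_mul] at h2
    exact PowerSeries.coeff_order hi₀.2 h2

/-- **Puiseux's theorem**, tame case: a monic polynomial of degree `d` over `k⟦T⟧` splits after a
substitution `T ↦ T ^ n` with `n` invertible in `k`, if `k` is algebraically closed and `1, …, d`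
are invertible in `k`. -/
theorem Polynomial.Monic.exists_splits_map_expand {k : Type*} [Field k] [IsAlgClosed k]
    {f : (PowerSeries k)[X]} (hf : f.Monic)
    (hk : ∀ j : ℕ, 1 ≤ j → j ≤ f.natDegree → (j : k) ≠ 0) :
    ∃ (n : ℕ) (hn : n ≠ 0), (n : k) ≠ 0 ∧
      (f.map (PowerSeries.expand (R := k) n hn : PowerSeries k →+* PowerSeries k)).Splits := by
  induction hd : f.natDegree using Nat.strong_induction_on generalizing f with
  | _ d ih =>
  rcases d with _ | d
  · exact ⟨1, one_ne_zero, by simp, Splits.of_natDegree_eq_zero (by rw [hf.natDegree_map, hd])⟩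
  have hk1 : (d + 1 : k) ≠ 0 := by exact_mod_cast hk (d + 1) (by lia) hd.ge
  -- a translation removes the coefficient below the leading one
  set t : PowerSeries k := -(PowerSeries.C (d + 1 : k)⁻¹ * f.coeff d) with ht
  set f₁ := Polynomial.taylor t f with hf₁
  have hf₁m : f₁.Monic := hf.taylor t
  have hf₁d : f₁.natDegree = d + 1 := by rw [hf₁, natDegree_taylor, hd]
  have hf₁0 : f₁.coeff d = 0 := by
    have h1 : (d + 1 : PowerSeries k) * PowerSeries.C (d + 1 : k)⁻¹ = 1 := by
      have : (d + 1 : PowerSeries k) = PowerSeries.C (d + 1 : k) := by simp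
      rw [this, ← map_mul, mul_inv_cancel₀ hk1, map_one]
    rw [hf₁, hf.coeff_taylor_of_natDegree_eq_succ hd, ht, mul_neg, ← mul_assoc, h1, one_mul,
      add_neg_cancel]
  have hback : f = Polynomial.taylor (-t) f₁ := by
    rw [hf₁, taylor_taylor, neg_add_cancel, taylor_zero]
  suffices H : ∃ (n : ℕ) (hn : n ≠ 0), (n : k) ≠ 0 ∧
      (f₁.map (PowerSeries.expand (R := k) n hn : PowerSeries k →+* PowerSeries k)).Splits by
    obtain ⟨n, hn, hnk, hsp⟩ := H
    refine ⟨n, hn, hnk, ?_⟩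
    rw [hback, map_taylor]
    exact hsp.taylor _
  by_cases hne : ∃ i < f₁.natDegree, f₁.coeff i ≠ 0
  · have hm : (d + 1).factorial ≠ 0 := Nat.factorial_ne_zero _
    have hmk : ((d + 1).factorial : k) ≠ 0 := by
      rw [← Finset.prod_range_add_one_eq_factorial, Nat.cast_prod, Finset.prod_ne_zero_iff]
      intro j hj
      exact hk (j + 1) (by lia) (by have := Finset.mem_range.1 hj; lia)
    obtain ⟨s, b, hbm, hbd, hbs, hbne⟩ := hf₁m.exists_map_expand_eq_scaleRoots hne hm
      fun j hj hj' => Nat.dvd_factorial hj (hf₁d ▸ hj')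
    rw [hf₁d] at hbd
    have hb0 : b.coeff d = 0 := by
      have := congrArg (fun p => p.coeff d) hbs
      simp only [coeff_map, hf₁0, map_zero, coeff_scaleRoots] at this
      exact (mul_eq_zero.1 this.symm).resolve_right
        (pow_ne_zero _ (pow_ne_zero _ PowerSeries.X_ne_zero))
    obtain ⟨g, q, hg, hq, hgq, hgd, hqd⟩ :=
      hbm.exists_mul_of_coeff_eq_zero hbd hk1 hb0 hbne
    obtain ⟨n₁, hn₁, hnk₁, hs₁⟩ := ih g.natDegree (by lia) hg
      (fun j hj hj' => hk j hj (by lia)) rfl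
    obtain ⟨n₂, hn₂, hnk₂, hs₂⟩ := ih q.natDegree (by lia) hq
      (fun j hj hj' => hk j hj (by lia)) rfl
    have hn12 : n₁ * n₂ ≠ 0 := mul_ne_zero hn₁ hn₂
    have hb : (b.map (PowerSeries.expand (R := k) (n₁ * n₂) hn12 :
        PowerSeries k →+* PowerSeries k)).Splits := by
      rw [hgq, Polynomial.map_mul]
      refine Splits.mul ?_ ?_
      · have h1 := hs₁.map (PowerSeries.expand (R := k) n₂ hn₂ : PowerSeries k →+* PowerSeries k)
        rw [Polynomial.map_map] at h1
        convert h1 using 2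
        ext1 x
        simp [← PowerSeries.expand_mul, mul_comm]
      · have h1 := hs₂.map (PowerSeries.expand (R := k) n₁ hn₁ : PowerSeries k →+* PowerSeries k)
        rw [Polynomial.map_map] at h1
        convert h1 using 2
        ext1 x
        simp [← PowerSeries.expand_mul]
    refine ⟨n₁ * n₂ * (d + 1).factorial, mul_ne_zero hn12 hm, ?_, ?_⟩
    · push_cast
      exact mul_ne_zero (mul_ne_zero hnk₁ hnk₂) hmk
    · have hcomp : (PowerSeries.expand (R := k) (n₁ * n₂ * (d + 1).factorial) (mul_ne_zero hn12 hm) :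
          PowerSeries k →+* PowerSeries k) =
          (PowerSeries.expand (R := k) (n₁ * n₂) hn12 : PowerSeries k →+* PowerSeries k).comp
            (PowerSeries.expand (R := k) (d + 1).factorial hm : PowerSeries k →+* PowerSeries k) := by
        ext1 x
        simp [← PowerSeries.expand_mul]
      rw [hcomp, ← Polynomial.map_map, hbs, map_scaleRoots _ _ _ (by simp [hbm.leadingCoeff])]
      exact hb.scaleRoots _
  · push Not at hne
    refine ⟨1, one_ne_zero, by simp, Splits.map ?_ _⟩
    have hX : f₁ = X ^ (d + 1) := by
      rw [hf₁m.as_sum, Finset.sum_eq_zero, hf₁d, add_zero]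
      intro i hi
      rw [hne i (Finset.mem_range.1 hi), C_0, zero_mul]
    rw [hX]
    exact Splits.X_pow _

namespace Puiseux

/-! ### Power series in `X ^ (1 / n)` -/

/-- The embedding `k⟦T⟧ → ⋃ₑ k((X^{1/e}))`, `T ↦ X^{1/n}`. -/
noncomputable def ofRoot (k : Type*) [Field k] (n : ℕ) (hn : n ≠ 0) :
    PowerSeries k →+* HahnSeries ℚ k :=
  have hn' : (0 : ℚ) < n := by exact_mod_cast Nat.pos_of_ne_zero hn
  (HahnSeries.embDomainRingHom
    { toFun := fun j : ℕ => (j : ℚ) / n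
      map_zero' := by simp
      map_add' := fun i j => by push_cast; ring }
    (fun i j h => by simpa [div_left_inj' hn'.ne'] using h)
    (fun i j => by simp [div_le_div_iff_of_pos_right hn'])).comp
  (HahnSeries.toPowerSeries (R := k)).symm.toRingHom

section ofRoot

variable {k : Type*} [Field k] {n : ℕ} (hn : n ≠ 0)

theorem coeff_ofRoot (x : PowerSeries k) (j : ℕ) :
    (ofRoot k n hn x).coeff ((j : ℚ) / n) = PowerSeries.coeff j x := by
  have hn' : (0 : ℚ) < n := by exact_mod_cast Nat.pos_of_ne_zero hn
  exact (HahnSeries.embDomain_mk_coeff (f := fun j : ℕ => (j : ℚ) / n)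
    (fun i j h => by simpa [div_left_inj' hn'.ne'] using h)
    (fun i j => by simp [div_le_div_iff_of_pos_right hn'])
    (x := HahnSeries.toPowerSeries.symm x) (a := j)).trans
    (HahnSeries.toPowerSeries_symm_apply_coeff x j)

theorem exists_eq_div_of_mem_support_ofRoot {x : PowerSeries k} {α : ℚ}
    (hα : α ∈ (ofRoot k n hn x).support) :
    ∃ j : ℕ, α = (j : ℚ) / n ∧ PowerSeries.coeff j x ≠ 0 := by
  obtain ⟨j, -, rfl⟩ := HahnSeries.support_embDomain_subset hα
  exact ⟨j, rfl, by rw [← coeff_ofRoot hn]; exact hα⟩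

theorem ofRoot_injective : Function.Injective (ofRoot k n hn) := fun x y h => by
  ext j
  rw [← coeff_ofRoot hn, ← coeff_ofRoot hn, h]

theorem le_orderTop_ofRoot {x : PowerSeries k} {a : ℕ}
    (hx : ∀ j < a, PowerSeries.coeff j x = 0) :
    ((((a : ℚ) / n : ℚ)) : WithTop ℚ) ≤ (ofRoot k n hn x).orderTop := by
  have hn' : (0 : ℚ) < n := by exact_mod_cast Nat.pos_of_ne_zero hn
  rw [HahnSeries.le_orderTop_iff_forall]
  intro α hα
  by_contra hne
  obtain ⟨j, rfl, hj⟩ := exists_eq_div_of_mem_support_ofRoot hn hne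
  rw [WithTop.coe_lt_coe, div_lt_div_iff_of_pos_right hn', Nat.cast_lt] at hα
  exact hj (hx j hα)

theorem orderTop_ofRoot_eq {x : PowerSeries k} {a : ℕ}
    (hx : ∀ j < a, PowerSeries.coeff j x = 0) (ha : PowerSeries.coeff a x ≠ 0) :
    (ofRoot k n hn x).orderTop = (((a : ℚ) / n : ℚ) : WithTop ℚ) := by
  refine le_antisymm (HahnSeries.orderTop_le_of_coeff_ne_zero ?_) (le_orderTop_ofRoot hn hx)
  rwa [coeff_ofRoot]

theorem orderTop_ofRoot_nonneg (x : PowerSeries k) : 0 ≤ (ofRoot k n hn x).orderTop := by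
  have := le_orderTop_ofRoot hn (x := x) (a := 0) (by simp)
  simpa using this

theorem ofRoot_C (c : k) : ofRoot k n hn (PowerSeries.C c) = HahnSeries.C c := by
  ext α
  by_cases hα : α = 0
  · subst hα
    have := coeff_ofRoot hn (PowerSeries.C c) 0
    simpa using this
  · rw [HahnSeries.C_apply, HahnSeries.coeff_single_of_ne hα]
    by_contra hne
    obtain ⟨j, rfl, hj⟩ := exists_eq_div_of_mem_support_ofRoot hn hne
    rw [PowerSeries.coeff_C] at hj
    have : j ≠ 0 := fun h => hα (by simp [h])
    simp [this] at hj

theorem ofRoot_X_pow : ofRoot k n hn (PowerSeries.X ^ n) = HahnSeries.single 1 1 := by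
  have hn' : (n : ℚ) ≠ 0 := by exact_mod_cast hn
  ext α
  by_cases hα : α = 1
  · subst hα
    have := coeff_ofRoot hn (PowerSeries.X ^ n : PowerSeries k) n
    rw [div_self hn'] at this
    simp [this, -map_pow]
  · rw [HahnSeries.coeff_single_of_ne hα]
    by_contra hne
    obtain ⟨j, rfl, hj⟩ := exists_eq_div_of_mem_support_ofRoot hn hne
    rw [PowerSeries.coeff_X_pow] at hj
    have : j ≠ n := fun h => hα (by rw [h, div_self hn'])
    simp [this] at hj

end ofRoot

/-- The embedding `K[X] → K̄⟦T⟧`, `X ↦ T ^ n`. -/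
noncomputable def polyToRoot (K : Type*) [Field K] (n : ℕ) (hn : n ≠ 0) :
    K[X] →+* PowerSeries (AlgebraicClosure K) :=
  (PowerSeries.expand (R := AlgebraicClosure K) n hn :
      PowerSeries (AlgebraicClosure K) →+* PowerSeries (AlgebraicClosure K)).comp
    (coeToPowerSeries.ringHom.comp (mapRingHom (algebraMap K (AlgebraicClosure K))))

section polyToRoot

variable {K : Type*} [Field K] {n : ℕ} (hn : n ≠ 0)

theorem polyToRoot_C (a : K) :
    polyToRoot K n hn (C a) = PowerSeries.C (algebraMap K (AlgebraicClosure K) a) := by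
  simp [polyToRoot, PowerSeries.expand_C]

theorem polyToRoot_X : polyToRoot K n hn X = PowerSeries.X ^ n := by
  simp [polyToRoot]

theorem ofRoot_comp_polyToRoot :
    (ofRoot (AlgebraicClosure K) n hn).comp (polyToRoot K n hn) = ofPoly K := by
  refine Polynomial.ringHom_ext (fun a => ?_) ?_
  · simp [polyToRoot_C, ofRoot_C, ofPoly]
  · rw [RingHom.comp_apply, polyToRoot_X, ofRoot_X_pow]
    simp [ofPoly]

theorem evalAt_ofRoot (F : K[X][X]) (s : PowerSeries (AlgebraicClosure K)) :
    evalAt F (ofRoot _ n hn s) = ofRoot _ n hn ((F.map (polyToRoot K n hn)).eval s) := by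
  rw [eval_map, hom_eval₂, ofRoot_comp_polyToRoot, evalAt]

/-- The automorphism `T ↦ u T` of `K̄⟦T⟧` fixes `K[X]`, where `X = T ^ n`, if `u ^ n = 1`. -/
theorem rescale_comp_polyToRoot {u : AlgebraicClosure K} (hu : u ^ n = 1) :
    (PowerSeries.rescale u).comp (polyToRoot K n hn) = polyToRoot K n hn := by
  refine Polynomial.ringHom_ext (fun a => ?_) ?_
  · rw [RingHom.comp_apply, polyToRoot_C]
    ext j
    rw [PowerSeries.coeff_rescale, PowerSeries.coeff_C]
    split_ifs with hj <;> simp [hj]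
  · rw [RingHom.comp_apply, polyToRoot_X, map_pow, PowerSeries.rescale_X, mul_pow, ← map_pow, hu,
      map_one, one_mul]

theorem eval_rescale_eq_zero {F : K[X][X]} {u : AlgebraicClosure K} (hu : u ^ n = 1)
    {s : PowerSeries (AlgebraicClosure K)} (hs : (F.map (polyToRoot K n hn)).eval s = 0) :
    (F.map (polyToRoot K n hn)).eval (PowerSeries.rescale u s) = 0 := by
  have h := congrArg (PowerSeries.rescale u) hs
  rwa [eval_map, hom_eval₂, rescale_comp_polyToRoot hn hu, map_zero, ← eval_map] at h

end polyToRoot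

theorem orderTop_ofPoly {K : Type*} [Field K] {p : K[X]} (hp : p ≠ 0) :
    (ofPoly K p).orderTop = ((p.natTrailingDegree : ℚ) : WithTop ℚ) := by
  rw [← ofRoot_comp_polyToRoot one_ne_zero, RingHom.comp_apply,
    orderTop_ofRoot_eq (a := p.natTrailingDegree)]
  · simp
  · intro j hj
    simp [polyToRoot, coeff_eq_zero_of_lt_natTrailingDegree hj]
  · simpa [polyToRoot] using fun h => hp (trailingCoeff_eq_zero.1 h)

theorem orderTop_prod {Γ R ι : Type*} [AddCommMonoid Γ] [LinearOrder Γ]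
    [IsOrderedCancelAddMonoid Γ] [CommRing R] [IsDomain R] (s : Finset ι)
    (f : ι → HahnSeries Γ R) : (∏ i ∈ s, f i).orderTop = ∑ i ∈ s, (f i).orderTop := by
  classical
  induction s using Finset.induction_on with
  | empty => simp
  | insert a s ha ih => rw [Finset.prod_insert ha, Finset.sum_insert ha, HahnSeries.orderTop_mul, ih]

/-! ### The Puiseux series of `F` and the sum of the valuations `v` -/

theorem _root_.Polynomial.Separable.map_of_isFractionRing {A k L : Type*} [CommRing A] [IsDomain A]
    [Field k] [Field L] [Algebra A k] [IsFractionRing A k] {p : A[X]}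
    (hp : (p.map (algebraMap A k)).Separable) {g : A →+* L} (hg : Function.Injective g) :
    (p.map g).Separable := by
  have h := hp.map (f := IsFractionRing.lift (K := k) hg)
  have hcomp : (IsFractionRing.lift (K := k) hg).comp (algebraMap A k) = g :=
    RingHom.ext fun x => IsFractionRing.lift_algebraMap hg x
  rwa [Polynomial.map_map, hcomp] at h

section roots

variable {K : Type*} [Field K] {F : K[X][X]}

theorem separable_map_ofPoly
    (hsep : (F.map (algebraMap (Polynomial K) (RatFunc K))).Separable) :
    (F.map (ofPoly K)).Separable :=
  Polynomial.Separable.map_of_isFractionRing hsep (ofPoly_injective K)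

theorem exists_splits_map_polyToRoot (hmonic : F.Monic)
    (hchar : ringChar K = 0 ∨ F.natDegree < ringChar K) :
    ∃ (n : ℕ) (hn : n ≠ 0), (n : AlgebraicClosure K) ≠ 0 ∧
      (F.map (polyToRoot K n hn)).Splits := by
  obtain ⟨n, hn, hnk, hs⟩ := (hmonic.map (coeToPowerSeries.ringHom.comp
    (mapRingHom (algebraMap K (AlgebraicClosure K))))).exists_splits_map_expand
    (fun j hj hj' h => by
      rw [hmonic.natDegree_map] at hj'
      have h0 : (j : K) = 0 := by
        apply (algebraMap K (AlgebraicClosure K)).injective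
        simpa using h
      rw [ringChar.spec] at h0
      have := Nat.le_of_dvd hj h0
      rcases hchar with hc | hc
      · rw [hc, zero_dvd_iff] at h0
        lia
      · lia)
  exact ⟨n, hn, hnk, by rwa [Polynomial.map_map] at hs⟩

variable {n : ℕ} (hn : n ≠ 0)

theorem exists_ofRoot_of_evalAt_eq_zero (hmonic : F.Monic)
    (hs : (F.map (polyToRoot K n hn)).Splits) {S : Series K} (hS : evalAt F S = 0) :
    ∃ s, (F.map (polyToRoot K n hn)).eval s = 0 ∧ ofRoot _ n hn s = S := by
  have h0 : F.map (polyToRoot K n hn) ≠ 0 := (hmonic.map _).ne_zero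
  have h1 : S ∈ (F.map (ofPoly K)).roots := by
    rw [mem_roots (hmonic.map _).ne_zero, IsRoot.def, eval_map]
    exact hS
  rw [← ofRoot_comp_polyToRoot hn, ← Polynomial.map_map,
    hs.roots_map_of_injective (ofRoot_injective hn), Multiset.mem_map] at h1
  obtain ⟨s, hs, rfl⟩ := h1
  exact ⟨s, (mem_roots h0).1 hs, rfl⟩

theorem ofRoot_mem_puiseuxSeries {s : PowerSeries (AlgebraicClosure K)}
    (h : (F.map (polyToRoot K n hn)).eval s = 0) : ofRoot _ n hn s ∈ puiseuxSeries F := by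
  refine ⟨⟨n, Nat.pos_of_ne_zero hn, fun α hα => ?_⟩, by rw [evalAt_ofRoot, h, map_zero]⟩
  obtain ⟨j, rfl, -⟩ := exists_eq_div_of_mem_support_ofRoot hn hα
  exact ⟨j, by simp⟩

variable (hmonic : F.Monic) (hs : (F.map (polyToRoot K n hn)).Splits)
  (hsep : (F.map (ofPoly K)).Separable)
include hmonic hs hsep

/-- The Puiseux series of `F` are `deg_Y F` in number, and their valuations `v` can be computed in
the factorization of `F`. -/
theorem exists_finset_puiseuxSeries [DecidableEq (Series K)] : ∃ P : Finset (Series K),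
    (P : Set (Series K)) = puiseuxSeries F ∧ P.card = F.natDegree ∧
    (∀ S ∈ P, v F S = ∑ T ∈ P.erase S, (S - T).orderTop) ∧
    (delta F ≠ 0 → ∑ S ∈ P, v F S = ((delta F : ℚ) : WithTop ℚ)) := by
  set G := F.map (ofPoly K) with hG
  have hGm : G.Monic := hmonic.map _
  have hGs : G.Splits := by
    rw [hG, ← ofRoot_comp_polyToRoot hn, ← Polynomial.map_map]
    exact hs.map _
  set P : Finset (Series K) := ⟨G.roots, nodup_roots hsep⟩ with hP
  have hv : ∀ S, v F S = (G.derivative.eval S).orderTop := fun S => by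
    rw [v, hG, derivative_map, eval_map, evalAt]
  refine ⟨P, ?_, ?_, fun S hS => ?_, fun hδ => ?_⟩
  · ext S
    change S ∈ G.roots ↔ _
    rw [mem_roots hGm.ne_zero, IsRoot.def, hG, eval_map]
    refine ⟨fun h => ?_, fun h => h.2⟩
    obtain ⟨s, hs0, rfl⟩ := exists_ofRoot_of_evalAt_eq_zero hn hmonic hs h
    exact ofRoot_mem_puiseuxSeries hn hs0
  · rw [Finset.card_mk, ← hGs.natDegree_eq_card_roots, hG, hmonic.natDegree_map]
  · rw [hv, hGs.eval_root_derivative hGm hS, ← orderTop_prod]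
    rfl
  · have hR : resultant F (derivative F) ≠ 0 := fun h => hδ (by rw [delta, h]; simp)
    have h1 := resultant_eq_prod_eval G G.derivative (derivative F).natDegree
      (by rw [hG, derivative_map]; exact natDegree_map_le) hGs
    rw [hGm.leadingCoeff, one_pow, one_mul, hG, hmonic.natDegree_map, derivative_map,
      resultant_map_map] at h1
    rw [delta, ← orderTop_ofPoly hR, h1, Finset.sum_congr rfl fun S _ => hv S, ← orderTop_prod,
      hG, derivative_map]
    rfl

end roots

/-! ### The regularity index -/

theorem ramificationIndex_dvd {K : Type*} [Field K] {S : Series K} {n : ℕ} (h : InLaurent n S) :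
    ramificationIndex S ∣ n := by
  set e := ramificationIndex S with he
  have hS : InLaurent e S := inLaurent_ramificationIndex ⟨n, h⟩
  have he0 : (e : ℚ) ≠ 0 := by exact_mod_cast hS.1.ne'
  have hn0 : (n : ℚ) ≠ 0 := by exact_mod_cast h.1.ne'
  have hg : 0 < e.gcd n := Nat.gcd_pos_of_pos_left _ hS.1
  have hL : InLaurent (e.gcd n) S := by
    refine ⟨hg, fun α hα => ?_⟩
    obtain ⟨a, ha⟩ := hS.2 α hα
    obtain ⟨b, hb⟩ := h.2 α hα
    refine ⟨a * Nat.gcdA e n + b * Nat.gcdB e n, ?_⟩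
    have hbez : ((e.gcd n : ℕ) : ℚ) = e * Nat.gcdA e n + n * Nat.gcdB e n := by
      exact_mod_cast Nat.gcd_eq_gcd_ab e n
    have hg0 : ((e.gcd n : ℕ) : ℚ) ≠ 0 := by exact_mod_cast hg.ne'
    rw [eq_div_iff hg0, hbez]
    push_cast
    rw [eq_div_iff he0] at ha
    rw [eq_div_iff hn0] at hb
    rw [← ha, ← hb]
    ring
  have hle : e ≤ e.gcd n := Nat.sInf_le hL
  have : e.gcd n = e := le_antisymm (Nat.gcd_le_left _ hS.1) hle
  exact this ▸ Nat.gcd_dvd_right e n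

/-- The conjugates of `s'` under `T ↦ ζ T`, for `ζ` a root of unity of order `m`, agree with `s` below
the exponent `a` where `s` and `s'` first differ, if `s` is a series in `T ^ m`. At least `q` of them
are distinct, where `q` is the order of `ζ ^ a`, so that `q a` is a multiple of `m`. -/
theorem exists_conjugates {k : Type*} [Field k] {s s' : PowerSeries k} {m a : ℕ} (hm : m ≠ 0)
    {ζ : k} (hζ : IsPrimitiveRoot ζ m) (hs : ∀ j, ¬ m ∣ j → PowerSeries.coeff j s = 0)
    (hlt : ∀ j < a, PowerSeries.coeff j s = PowerSeries.coeff j s')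
    (hne : PowerSeries.coeff a s ≠ PowerSeries.coeff a s') :
    ∃ q : ℕ, 0 < q ∧ m ∣ q * a ∧
      Set.InjOn (fun i => PowerSeries.rescale (ζ ^ i) s') (Set.Iio q) ∧
      ∀ i, PowerSeries.rescale (ζ ^ i) s' ≠ s ∧
        ∀ j < a, PowerSeries.coeff j (s - PowerSeries.rescale (ζ ^ i) s') = 0 := by
  have hs' : ∀ i j, (ζ ^ i) ^ j * PowerSeries.coeff j s = PowerSeries.coeff j s := fun i j => by
    by_cases hj : m ∣ j
    · rw [← pow_mul, mul_comm i, pow_mul, (hζ.pow_eq_one_iff_dvd j).2 hj, one_pow, one_mul]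
    · rw [hs j hj, mul_zero]
  have hζ0 : ζ ≠ 0 := hζ.ne_zero hm
  have hfin : (ζ ^ a) ^ m = 1 := by rw [← pow_mul, mul_comm, pow_mul, hζ.pow_eq_one, one_pow]
  refine ⟨orderOf (ζ ^ a), ?_, ?_, ?_, fun i => ⟨fun h => hne ?_, fun j hj => ?_⟩⟩
  · exact orderOf_pos_iff.2 (isOfFinOrder_iff_pow_eq_one.2 ⟨m, Nat.pos_of_ne_zero hm, hfin⟩)
  · rw [← hζ.pow_eq_one_iff_dvd, mul_comm, pow_mul, pow_orderOf_eq_one]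
  · intro i hi i' hi' heq
    have h1 := congrArg (PowerSeries.coeff a) heq
    simp only [PowerSeries.coeff_rescale] at h1
    by_cases hc : PowerSeries.coeff a s' = 0
    · -- then `s` has the exponent `a`, which is therefore a multiple of `m`
      have ha : m ∣ a := by
        by_contra hcon
        exact hne ((hs a hcon).trans hc.symm)
      rw [(hζ.pow_eq_one_iff_dvd a).2 ha, orderOf_one, Set.mem_Iio] at hi hi'
      lia
    · refine pow_injOn_Iio_orderOf hi hi' ?_
      have h2 := mul_right_cancel₀ hc h1
      simpa [← pow_mul, mul_comm] using h2
  · have h1 := congrArg (PowerSeries.coeff a) h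
    rw [PowerSeries.coeff_rescale, ← hs' i a] at h1
    exact (mul_left_cancel₀ (pow_ne_zero _ (pow_ne_zero _ hζ0)) h1).symm
  · rw [map_sub, PowerSeries.coeff_rescale, ← hlt j hj, hs', sub_self]

/-- The regularity exponent `r / e` is at most `v`. If `S'` is a Puiseux series which the truncation
of `S` at `(r - 1) / e` fails to separate from `S`, then `S` and `S'` first differ at an exponent
`α > (r - 1) / e`, and `S'` has `q` conjugates over `K̄((X^{1/e}))` at least as close to `S` as
itself, where `q α` lies in `(1 / e) ℤ`. They contribute at least `q α ≥ r / e` to `v`. -/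
theorem regularityIndex_div_le_v {K : Type*} [Field K] [DecidableEq (Series K)] {F : K[X][X]}
    (hmonic : F.Monic) {n : ℕ} (hn : n ≠ 0) (hnk : (n : AlgebraicClosure K) ≠ 0)
    (hs : (F.map (polyToRoot K n hn)).Splits) {P : Finset (Series K)}
    (hP : (P : Set (Series K)) = puiseuxSeries F)
    (hv : ∀ S ∈ P, v F S = ∑ T ∈ P.erase S, (S - T).orderTop) {S : Series K} (hS : S ∈ P) :
    (((regularityIndex F S : ℚ) / (ramificationIndex S : ℚ) : ℚ) : WithTop ℚ) ≤ v F S := by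
  have hmem : ∀ T ∈ P, ∃ t, (F.map (polyToRoot K n hn)).eval t = 0 ∧ ofRoot _ n hn t = T :=
    fun T hT => exists_ofRoot_of_evalAt_eq_zero hn hmonic hs
      (show T ∈ puiseuxSeries F from hP ▸ hT).2
  have hnonneg : ∀ T ∈ P, 0 ≤ (S - T).orderTop := fun T hT => by
    obtain ⟨s, -, rfl⟩ := hmem S hS
    obtain ⟨t, -, rfl⟩ := hmem T hT
    rw [← map_sub]
    exact orderTop_ofRoot_nonneg hn _
  rw [hv S hS]
  have hSF : S ∈ puiseuxSeries F := hP ▸ hS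
  obtain ⟨s, hs0, rfl⟩ := hmem S hS
  set S := ofRoot _ n hn s with hSdef
  set e := ramificationIndex S with he
  have heL : InLaurent e S := inLaurent_ramificationIndex hSF.1
  have he0 : (0 : ℚ) < e := by exact_mod_cast heL.1
  have hn0 : (0 : ℚ) < n := by exact_mod_cast Nat.pos_of_ne_zero hn
  obtain ⟨m, hm⟩ : e ∣ n := ramificationIndex_dvd ⟨Nat.pos_of_ne_zero hn, fun α hα => by
    obtain ⟨j, rfl, -⟩ := exists_eq_div_of_mem_support_ofRoot hn hα
    exact ⟨j, by simp⟩⟩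
  have hm0 : m ≠ 0 := by rintro rfl; exact hn (by simpa using hm)
  have hm0' : (0 : ℚ) < m := by exact_mod_cast Nat.pos_of_ne_zero hm0
  have hnm : (n : ℚ) = e * m := by exact_mod_cast hm
  have hleast := isLeast_regularityIndex hmonic.ne_zero hSF
  set r := regularityIndex F S with hr
  rcases le_or_gt r 0 with hr0 | hr0
  · refine le_trans ?_ (Finset.sum_nonneg fun T hT => hnonneg T (Finset.mem_of_mem_erase hT))
    rw [← WithTop.coe_zero, WithTop.coe_le_coe]
    exact div_nonpos_of_nonpos_of_nonneg (by exact_mod_cast hr0) he0.le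
  obtain ⟨r', hr'⟩ : ∃ r' : ℕ, r = r' + 1 := ⟨(r - 1).toNat, by lia⟩
  -- By minimality `r - 1` does not separate `S` from all other Puiseux series.
  obtain ⟨S', hS'F, htr, hSS'⟩ : ∃ S' ∈ puiseuxSeries F,
      trunc S ((r' : ℚ) / e) = trunc S' ((r' : ℚ) / e) ∧ S ≠ S' := by
    by_contra! hcon
    have : (r' : ℤ) ∈ regularitySet F S :=
      ⟨(min_le_left _ _).trans (by simp), fun S' hS' h => hcon S' hS' (by simpa using h)⟩
    have := hleast.2 this
    lia
  obtain ⟨s', hs'0, rfl⟩ := hmem S' (by rw [← Finset.mem_coe, hP]; exact hS'F)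
  have hex : ∃ a, PowerSeries.coeff a s ≠ PowerSeries.coeff a s' := by
    by_contra! hcon
    exact hSS' (congrArg (ofRoot _ n hn) (PowerSeries.ext hcon))
  classical
  set a := Nat.find hex with ha
  have hane : PowerSeries.coeff a s ≠ PowerSeries.coeff a s' := Nat.find_spec hex
  have halt : ∀ j < a, PowerSeries.coeff j s = PowerSeries.coeff j s' := fun j hj => by
    simpa using Nat.find_min hex hj
  have har : r' * m < a := by
    by_contra! hcon
    have h1 := congrArg (fun U : Series K => U.coeff ((a : ℚ) / n)) htr
    have h2 : (a : ℚ) / n ≤ r' / e := by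
      rw [hnm, div_le_div_iff₀ (by positivity) he0]
      have : (a : ℚ) ≤ r' * m := by exact_mod_cast hcon
      nlinarith
    simp only [trunc, if_pos h2, hSdef, coeff_ofRoot] at h1
    exact hane h1
  have hsupp : ∀ j, ¬ m ∣ j → PowerSeries.coeff j s = 0 := fun j hj => by
    by_contra hne
    obtain ⟨b, hb⟩ := heL.2 ((j : ℚ) / n) (by
      rw [HahnSeries.mem_support, hSdef, coeff_ofRoot]
      exact hne)
    rw [hnm, div_eq_div_iff (by positivity) he0.ne'] at hb
    have h1 : (j : ℚ) = m * b := by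
      apply mul_right_cancel₀ he0.ne'
      rw [hb]
      ring
    exact hj (Int.natCast_dvd_natCast.1 ⟨b, by exact_mod_cast h1⟩)
  have : NeZero (m : AlgebraicClosure K) := ⟨fun h => hnk (by rw [hm, Nat.cast_mul, h, mul_zero])⟩
  obtain ⟨ζ, hζ⟩ := HasEnoughRootsOfUnity.exists_primitiveRoot (AlgebraicClosure K) m
  obtain ⟨q, hq0, ⟨c, hqc⟩, hinj, hconj⟩ := exists_conjugates hm0 hζ hsupp halt hane
  set σ : ℕ → Series K := fun i => ofRoot _ n hn (PowerSeries.rescale (ζ ^ i) s') with hσ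
  have hσP : ∀ i, σ i ∈ P.erase S := fun i => by
    refine Finset.mem_erase.2 ⟨fun h => (hconj i).1 (ofRoot_injective hn h), ?_⟩
    rw [← Finset.mem_coe, hP]
    refine ofRoot_mem_puiseuxSeries hn (eval_rescale_eq_zero hn ?_ hs'0)
    rw [hm, ← pow_mul, mul_comm, mul_assoc, mul_comm m i, ← mul_assoc, mul_comm, pow_mul,
      hζ.pow_eq_one, one_pow]
  have hσord : ∀ i, (((a : ℚ) / n : ℚ) : WithTop ℚ) ≤ (S - σ i).orderTop := fun i => by
    rw [hSdef, hσ, ← map_sub]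
    exact le_orderTop_ofRoot hn (hconj i).2
  -- `q a = m c` is a multiple of `m` exceeding `m r'`.
  have hcr : r' + 1 ≤ c := by
    have h1 : m * r' < m * c := by
      rw [← hqc]
      nlinarith
    exact Nat.lt_of_mul_lt_mul_left h1
  calc (((r : ℚ) / e : ℚ) : WithTop ℚ)
      ≤ ((q • ((a : ℚ) / n) : ℚ) : WithTop ℚ) := by
        rw [WithTop.coe_le_coe, nsmul_eq_mul, ← mul_div_assoc, hnm, hr']
        have h1 : (q : ℚ) * a = m * c := by exact_mod_cast hqc
        have h2 : (r' : ℚ) + 1 ≤ c := by exact_mod_cast hcr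
        rw [h1, mul_comm (e : ℚ), mul_div_mul_left _ _ hm0'.ne']
        push_cast
        gcongr
    _ = ∑ i ∈ Finset.range q, (((a : ℚ) / n : ℚ) : WithTop ℚ) := by
        rw [Finset.sum_const, Finset.card_range, WithTop.coe_nsmul]
    _ ≤ ∑ i ∈ Finset.range q, (S - σ i).orderTop := Finset.sum_le_sum fun i _ => hσord i
    _ = ∑ T ∈ (Finset.range q).image σ, (S - T).orderTop := by
        rw [Finset.sum_image]
        intro i hi i' hi' h
        exact hinj (by simpa using hi) (by simpa using hi') (ofRoot_injective hn h)
    _ ≤ ∑ T ∈ P.erase S, (S - T).orderTop := by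
        refine Finset.sum_le_sum_of_subset_of_nonneg ?_ fun T hT _ =>
          hnonneg T (Finset.mem_of_mem_erase hT)
        intro T hT
        obtain ⟨i, -, rfl⟩ := Finset.mem_image.1 hT
        exact hσP i

/-! ### Counting -/

/-- Among nonnegative terms with a positive sum, at least half are less than twice the mean. -/
theorem half_card_le_card_filter_lt {ι : Type*} (P : Finset ι) (f : ι → WithTop ℚ)
    (hf : ∀ i ∈ P, 0 ≤ f i) {δ : ℚ} (hδ : 0 < δ) (hsum : ∑ i ∈ P, f i = (δ : WithTop ℚ))
    [DecidablePred fun i => f i < ((2 * δ / P.card : ℚ) : WithTop ℚ)] :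
    (P.card : ℚ) / 2 ≤ (P.filter fun i => f i < ((2 * δ / P.card : ℚ) : WithTop ℚ)).card := by
  rcases P.eq_empty_or_nonempty with rfl | hne
  · simp
  have hd : (0 : ℚ) < P.card := by exact_mod_cast hne.card_pos
  set B := P.filter fun i => ¬ f i < ((2 * δ / P.card : ℚ) : WithTop ℚ) with hB
  have hcard := P.card_filter_add_card_filter_not fun i => f i < ((2 * δ / P.card : ℚ) : WithTop ℚ)
  have h1 : ((B.card • (2 * δ / P.card) : ℚ) : WithTop ℚ) ≤ (δ : WithTop ℚ) := by
    rw [← hsum, WithTop.coe_nsmul]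
    refine (Finset.card_nsmul_le_sum B f _ fun i hi => not_lt.1 (Finset.mem_filter.1 hi).2).trans ?_
    exact Finset.sum_le_sum_of_subset_of_nonneg (Finset.filter_subset _ _) fun i hi _ => hf i hi
  rw [WithTop.coe_le_coe, nsmul_eq_mul, ← mul_div_assoc, div_le_iff₀ hd] at h1
  have h2 : (B.card : ℚ) * 2 ≤ P.card := by
    by_contra! hcon
    nlinarith
  have h3 : ((P.filter fun i => f i < ((2 * δ / P.card : ℚ) : WithTop ℚ)).card : ℚ) + B.card =
      P.card := by exact_mod_cast hcard
  linarith

end Puiseux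

theorem mainTheorem11 {K : Type*} [Field K] [PerfectField K] (F : Polynomial (Polynomial K))
    (hmonic : F.Monic)
    (hsep : (F.map (algebraMap (Polynomial K) (RatFunc K))).Separable)
    (hchar : ringChar K = 0 ∨ F.natDegree < ringChar K)
    (hdelta : 0 < Puiseux.delta F) :
    (F.natDegree : ℚ) / 2 ≤
      (({S ∈ Puiseux.puiseuxSeries F |
          Puiseux.v F S < ((2 * (Puiseux.delta F : ℚ) / (F.natDegree : ℚ) : ℚ) : WithTop ℚ) ∧
          Puiseux.N F S < ((4 * (Puiseux.delta F : ℚ) / (F.natDegree : ℚ) : ℚ) : WithTop ℚ)}.ncard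
        : ℕ) : ℚ) := by
  classical
  obtain ⟨n, hn, hnk, hs⟩ := Puiseux.exists_splits_map_polyToRoot hmonic hchar
  obtain ⟨P, hP, hcard, hv, hsum⟩ := Puiseux.exists_finset_puiseuxSeries hn hmonic hs
    (Puiseux.separable_map_ofPoly hsep)
  have hnonneg : ∀ S ∈ P, 0 ≤ Puiseux.v F S := fun S hS => by
    obtain ⟨s, -, rfl⟩ := Puiseux.exists_ofRoot_of_evalAt_eq_zero hn hmonic hs
      (show S ∈ Puiseux.puiseuxSeries F from hP ▸ hS).2
    rw [Puiseux.v, Puiseux.evalAt_ofRoot]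
    exact Puiseux.orderTop_ofRoot_nonneg hn _
  have hcount := Puiseux.half_card_le_card_filter_lt P (Puiseux.v F) hnonneg
    (by exact_mod_cast hdelta) (hsum hdelta.ne')
  rw [hcard] at hcount
  refine hcount.trans ?_
  rw [← Set.ncard_coe_finset]
  refine Nat.cast_le.2 (Set.ncard_le_ncard (fun S hS => ?_) ?_)
  · obtain ⟨hSP, hlt⟩ := Finset.mem_filter.1 (Finset.mem_coe.1 hS)
    refine ⟨hP ▸ hSP, hlt, ?_⟩
    have hreg := Puiseux.regularityIndex_div_le_v hmonic hn hnk hs hP hv hSP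
    rw [Puiseux.N]
    refine (add_le_add_left hreg _).trans_lt ?_
    obtain ⟨x, hx⟩ := WithTop.ne_top_iff_exists.1 hlt.ne_top
    rw [← hx] at hlt ⊢
    rw [WithTop.coe_lt_coe] at hlt
    rw [← WithTop.coe_add, WithTop.coe_lt_coe]
    calc x + x < 2 * (Puiseux.delta F : ℚ) / F.natDegree + 2 * (Puiseux.delta F : ℚ) / F.natDegree :=
          add_lt_add hlt hlt
      _ = 4 * (Puiseux.delta F : ℚ) / F.natDegree := by ring
  · exact (P.finite_toSet.subset (hP.symm ▸ Set.Subset.rfl)).subset fun S hS => hS.1
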